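/- **Theorem 2.8 (Harnack-type inequality).** Let $n$ be a natural number, let $\mathcal E$ and $\mathcal H$ be complex Hilbert spaces, and let $\gamma>0$. For a Hilbert space $\mathcal K$ put $$[B(\mathcal K)^n]_\gamma=\Big\{(X_1,\dots,X_n)\in B(\mathcal K)^n:\ \Big\|\sum_{i=1}^n X_iX_i^*\Big\|^{1/2}<\gamma\Big\},\qquad [B(\mathcal K)^n]_r^-=\Big\{X\in B(\mathcal K)^n:\ \Big\|\sum_{i=1}^n X_iX_i^*\Big\|^{1/2}\le r\Big\}.$$ Let $\mathbb F_n^+$ be the free unital semigroup on generators $g_1,\dots,g_n$; for $\alpha=g_{i_1}\cdots g_{i_k}$ write $|\alpha|=k$ and $X_\alpha=X_{i_1}\cdots X_{i_k}$ (with $X_\alpha=I$ for the empty word). A family $(A_{(\alpha)})_{\alpha\in\mathbb F_n^+}$ in $B(\mathcal E)$ has radius of convergence $R\in[0,\infty]$ given by $\frac1R=\limsup_{k\to\infty}\big\|\sum_{|\alpha|=k}A_{(\alpha)}^*A_{(\alpha)}\big\|^{1/2k}$; if $R\ge\gamma$, it defines on each Hilbert space $\mathcal K$ the free holomorphic function $F(X)=\sum_{k=0}^\infty\sum_{|\alpha|=k}A_{(\alpha)}\otimes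 X_\alpha\in B(\mathcal E\otimes\mathcal K)$, $X\in[B(\mathcal K)^n]_\gamma$ (operator norm convergence). A free pluriharmonic function $u$ with coefficients in $B(\mathcal E)$ is one of the form $u=\operatorname{Re}F+i\operatorname{Re}G$ with $F,G$ free holomorphic functions of this kind, where $\operatorname{Re}F=\frac12(F+F^*)$; the same coefficients define its representation on every Hilbert space $\mathcal K$. It is called positive if $u(X)\ge0$ for every Hilbert space $\mathcal K$ and every $X\in[B(\mathcal K)^n]_\gamma$. If $u$ is a positive free pluriharmonic function on $[B(\mathcal H)^n]_\gamma$ with coefficients in $B(\mathcal E)$ and $0<r<\gamma$, then $$\|u(X_1,\dots,X_n)\|\le\|u(0)\|\,\frac{\gamma+r}{\gamma-r}\qquad\text{for all }(X_1,\dots,X_n)\in[B(\mathcal H)^n]_r^-.$$ -/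

import Mathlib

open Filter Topology TensorProduct
open scoped ENNReal

universe u v w

noncomputable section

namespace FreePluriharmonic

/-- The Hilbert space tensor product `E ⊗ K` of two complex Hilbert spaces: the completion of the
algebraic tensor product with respect to `⟪x ⊗ y, x' ⊗ y'⟫ = ⟪x, x'⟫ ⟪y, y'⟫`. -/
abbrev HilbertTensor (E : Type u) (K : Type v)
    [NormedAddCommGroup E] [InnerProductSpace ℂ E]
    [NormedAddCommGroup K] [InnerProductSpace ℂ K] : Type (max u v) :=
  UniformSpace.Completion (E ⊗[ℂ] K)

/-- The bounded operator `A ⊗ X` on the Hilbert space `E ⊗ K`, that is, the continuous linear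
extension of `x ⊗ y ↦ A x ⊗ X y`. The closed linear span of these operators in `B(E ⊗ K)`, with
the operator norm of `B(E ⊗ K)`, is `B(E) ⊗_min B(K)`. -/
def opTensor {E : Type u} {K : Type v}
    [NormedAddCommGroup E] [InnerProductSpace ℂ E]
    [NormedAddCommGroup K] [InnerProductSpace ℂ K]
    (A : E →L[ℂ] E) (X : K →L[ℂ] K) : HilbertTensor E K →L[ℂ] HilbertTensor E K :=
  (TensorProduct.mapL A X).completion

/-- The row norm `‖X₁ X₁* + ⋯ + Xₙ Xₙ*‖ ^ (1/2)` of an `n`-tuple of operators. -/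
def rowNorm {n : ℕ} {K : Type v} [NormedAddCommGroup K] [InnerProductSpace ℂ K] [CompleteSpace K]
    (X : Fin n → K →L[ℂ] K) : ℝ :=
  Real.sqrt ‖∑ i, X i * star (X i)‖

/-- The open noncommutative ball `[B(K)ⁿ]_γ`. -/
def openBall (n : ℕ) (K : Type v) [NormedAddCommGroup K] [InnerProductSpace ℂ K] [CompleteSpace K]
    (γ : ℝ) : Set (Fin n → K →L[ℂ] K) :=
  {X | rowNorm X < γ}

/-- The closed noncommutative ball `[B(K)ⁿ]_r⁻`. -/
def closedBall (n : ℕ) (K : Type v) [NormedAddCommGroup K] [InnerProductSpace ℂ K]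
    [CompleteSpace K] (r : ℝ) : Set (Fin n → K →L[ℂ] K) :=
  {X | rowNorm X ≤ r}

/-- A family of coefficients `A_α ∈ B(E)`, indexed by the words `α` of the unital free semigroup
on `n` generators. It stands for the formal power series `∑ A_α ⊗ Z_α`. -/
abbrev Coeff (n : ℕ) (E : Type u) [NormedAddCommGroup E] [InnerProductSpace ℂ E] : Type u :=
  FreeMonoid (Fin n) → E →L[ℂ] E

/-- The word `g_{i₁} ⋯ g_{iₖ}` of length `k` given by the indices `i₁, …, iₖ`. Every word of
length `k` arises from exactly one such sequence of indices. -/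
def word {n k : ℕ} (i : Fin k → Fin n) : FreeMonoid (Fin n) :=
  FreeMonoid.ofList (List.ofFn i)

/-- The radius of convergence `R ∈ [0, ∞]` of `∑ A_α ⊗ Z_α`:
`1 / R = limsup_k ‖∑_{|α| = k} A_α* A_α‖ ^ (1 / (2k))`. -/
def radius {n : ℕ} {E : Type u} [NormedAddCommGroup E] [InnerProductSpace ℂ E] [CompleteSpace E]
    (A : Coeff n E) : ℝ≥0∞ :=
  (limsup (fun k : ℕ => ‖∑ i : Fin k → Fin n, star (A (word i)) * A (word i)‖ₑ
    ^ (1 / (2 * (k : ℝ)))) atTop)⁻¹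

/-- The homogeneous part `∑_{|α| = k} A_α ⊗ X_α`, where `X_α = X_{i₁} ⋯ X_{iₖ}` for
`α = g_{i₁} ⋯ g_{iₖ}` and `X_α = I` for the empty word. -/
def homPart {n : ℕ} {E : Type u} {K : Type v}
    [NormedAddCommGroup E] [InnerProductSpace ℂ E]
    [NormedAddCommGroup K] [InnerProductSpace ℂ K]
    (A : Coeff n E) (X : Fin n → K →L[ℂ] K) (k : ℕ) :
    HilbertTensor E K →L[ℂ] HilbertTensor E K :=
  ∑ i : Fin k → Fin n, opTensor (A (word i)) (FreeMonoid.lift X (word i))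

/-- `F` is the free holomorphic function on `[B(K)ⁿ]_γ` with coefficients `A`: the formal power
series has radius of convergence at least `γ`, and `F X = ∑ₖ ∑_{|α| = k} A_α ⊗ X_α`, with
convergence in the operator norm, for all `X` in `[B(K)ⁿ]_γ`. -/
def IsFreeHolomorphicWith {n : ℕ} {E : Type u} {K : Type v}
    [NormedAddCommGroup E] [InnerProductSpace ℂ E] [CompleteSpace E]
    [NormedAddCommGroup K] [InnerProductSpace ℂ K] [CompleteSpace K]
    (γ : ℝ) (A : Coeff n E)
    (F : (Fin n → K →L[ℂ] K) → HilbertTensor E K →L[ℂ] HilbertTensor E K) : Prop :=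
  ENNReal.ofReal γ ≤ radius A ∧
    ∀ X ∈ openBall n K γ,
      Tendsto (fun N : ℕ => ∑ k ∈ Finset.range N, homPart A X k) atTop (𝓝 (F X))

/-- The real part `(T + T*) / 2` of a bounded operator on a Hilbert space. -/
def rePart {L : Type w} [NormedAddCommGroup L] [InnerProductSpace ℂ L] [CompleteSpace L]
    (T : L →L[ℂ] L) : L →L[ℂ] L :=
  (2⁻¹ : ℂ) • (T + star T)

/-- `u` is the representation on the Hilbert space `K` of the free pluriharmonic function
`Re F + i Re G`, where `F` and `G` are the free holomorphic functions with coefficients `A` and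
`B`. Only the values of `u` on `[B(K)ⁿ]_γ` matter. -/
def IsRepresentation {n : ℕ} {E : Type u} {K : Type v}
    [NormedAddCommGroup E] [InnerProductSpace ℂ E] [CompleteSpace E]
    [NormedAddCommGroup K] [InnerProductSpace ℂ K] [CompleteSpace K]
    (γ : ℝ) (A B : Coeff n E)
    (u : (Fin n → K →L[ℂ] K) → HilbertTensor E K →L[ℂ] HilbertTensor E K) : Prop :=
  ∃ F G : (Fin n → K →L[ℂ] K) → HilbertTensor E K →L[ℂ] HilbertTensor E K,
    IsFreeHolomorphicWith γ A F ∧ IsFreeHolomorphicWith γ B G ∧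
      ∀ X ∈ openBall n K γ, u X = rePart (F X) + Complex.I • rePart (G X)

/-- `u` is a positive free pluriharmonic function on `[B(H)ⁿ]_γ` with coefficients in `B(E)`: it is
free pluriharmonic, and its representation on each Hilbert space `K` takes only positive
operators as values on `[B(K)ⁿ]_γ`. (The universe of `K` is arbitrary; each universe contains
Hilbert spaces of infinite dimension. The coefficients are determined by `u`, up to skew-adjoint
constant terms that do not affect the representations, as soon as `H` is infinite dimensional.) -/
def IsPositiveFreePluriharmonicOn {n : ℕ} {E : Type u} {H : Type v}
    [NormedAddCommGroup E] [InnerProductSpace ℂ E] [CompleteSpace E]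
    [NormedAddCommGroup H] [InnerProductSpace ℂ H] [CompleteSpace H]
    (γ : ℝ) (u : (Fin n → H →L[ℂ] H) → HilbertTensor E H →L[ℂ] HilbertTensor E H) : Prop :=
  ∃ A B : Coeff n E, IsRepresentation γ A B u ∧
    ∀ (K : Type w) [NormedAddCommGroup K] [InnerProductSpace ℂ K] [CompleteSpace K]
      (U : (Fin n → K →L[ℂ] K) → HilbertTensor E K →L[ℂ] HilbertTensor E K),
      IsRepresentation γ A B U → ∀ X ∈ openBall n K γ, (U X).IsPositive

end FreePluriharmonic

end

/-! Fix `X` in the closed ball of radius `r` and a vector `x`. The slice `z ↦ ⟪x, u(zX) x⟫` has the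
real part of `z ↦ ⟪x, F(zX) x⟫`, a scalar power series on the disc of radius `γ / r`. That real part
is nonnegative, so Harnack's inequality on the disc, taken at `z = 1`, bounds the form of `u X` by
`(γ + r) / (γ - r)` times that of `u 0` (`re_le_of_re_nonneg`, `IsRepresentation.re_inner_le`). As
`u X` is positive, its form controls its norm (`norm_le_of_isPositive`).

Positivity is assumed only on Hilbert spaces of a universe `w`, while `H` lives in `v`. It transfers
to `H` because an algebraic tensor involves finitely many vectors of `H`. These lie in a separable
subspace invariant under `X`, which has a copy in universe `w`, and compressing `u X` to that copy
preserves the form (`IsRepresentation.isPositive`). -/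

noncomputable section

namespace FreePluriharmonic

/-! ### Harnack's inequality on a disc -/

section ComplexAnalysis

/-- A power series whose partial sums converge pointwise on a disc has a holomorphic sum there. -/
theorem differentiableOn_of_tendsto_sum_pow {a : ℕ → ℂ} {f : ℂ → ℂ} {R : ℝ}
    (hf : ∀ z ∈ Metric.ball (0 : ℂ) R,
      Tendsto (fun N : ℕ => ∑ k ∈ Finset.range N, z ^ k * a k) atTop (𝓝 (f z))) :
    DifferentiableOn ℂ f (Metric.ball 0 R) := by
  rcases le_or_gt R 0 with hR | hR
  · simpa [Metric.ball_eq_empty.2 hR] using differentiableOn_empty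
  set p : FormalMultilinearSeries ℂ ℂ ℂ := FormalMultilinearSeries.ofScalars ℂ a with hp
  have hrad : ENNReal.ofReal R ≤ p.radius := by
    refine ENNReal.le_of_forall_nnreal_lt fun s hs => ?_
    have hsR : (s : ℝ) < R := by
      rw [ENNReal.lt_ofReal_iff_toReal_lt ENNReal.coe_ne_top] at hs
      simpa using hs
    have h1 := hf (s : ℝ) (by simpa using hsR)
    -- The terms of a convergent series tend to zero, so convergence at the real point `s` already
    -- forces the radius to be at least `s`.
    have h2 : Tendsto (fun k : ℕ => ((s : ℝ) : ℂ) ^ k * a k) atTop (𝓝 0) := by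
      have := ((tendsto_add_atTop_iff_nat 1).2 h1).sub h1
      simpa [Finset.sum_range_succ] using this
    refine p.le_radius_of_tendsto (l := 0) ?_
    have h3 := h2.norm
    simp only [norm_zero] at h3
    refine h3.congr fun k => ?_
    rw [hp, FormalMultilinearSeries.ofScalars_norm]
    simp [mul_comm]
  have hball := p.hasFPowerSeriesOnBall ((ENNReal.ofReal_pos.2 hR).trans_le hrad)
  have hsub : Metric.ball (0 : ℂ) R ⊆ Metric.eball 0 p.radius := by
    rw [← Metric.eball_ofReal]
    exact Metric.eball_subset_eball hrad
  refine (hball.differentiableOn.mono hsub).congr fun z hz => ?_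
  have h1 := (hball.hasSum (hsub hz)).tendsto_sum_nat
  rw [zero_add] at h1
  refine tendsto_nhds_unique (hf z hz) (h1.congr fun N => Finset.sum_congr rfl fun k _ => ?_)
  simp [hp, FormalMultilinearSeries.ofScalars, mul_comm]

/-- **Harnack's inequality** for the real part of a holomorphic function on a disc. -/
theorem re_le_of_re_nonneg {f : ℂ → ℂ} {R : ℝ} (hf : DifferentiableOn ℂ f (Metric.ball 0 R))
    (hpos : ∀ z ∈ Metric.ball (0 : ℂ) R, 0 ≤ (f z).re) {z : ℂ} (hz : z ∈ Metric.ball (0 : ℂ) R) :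
    (f z).re ≤ (f 0).re * ((R + ‖z‖) / (R - ‖z‖)) := by
  have hzR : ‖z‖ < R := by simpa using hz
  have hR : 0 < R := (norm_nonneg z).trans_lt hzR
  have hd : 0 < R - ‖z‖ := sub_pos.2 hzR
  have h0 := hpos 0 (by simpa using hR)
  -- Borel–Carathéodory applies to `f 0 - f`, which vanishes at `0` and has real part at most `(f
  -- 0).re`. It needs a positive bound, and `(f 0).re` may be zero, so `M` is taken larger and then
  -- sent to `(f 0).re`.
  have key : ∀ M, (f 0).re < M → (f z).re - (f 0).re ≤ M * (2 * ‖z‖ / (R - ‖z‖)) := by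
    intro M hM
    have := Complex.borelCaratheodory_zero (f := fun x => f 0 - f x) (h0.trans_lt hM)
      ((differentiableOn_const _).sub hf)
      (fun x hx => by
        have := hpos x hx
        simp only [Set.mem_ofPred_eq, Complex.sub_re]
        linarith) hR hz (by simp)
    have h2 := (neg_le_abs _).trans ((Complex.abs_re_le_norm _).trans this)
    simp only [Complex.sub_re] at h2
    calc (f z).re - (f 0).re ≤ 2 * M * ‖z‖ / (R - ‖z‖) := by linarith
      _ = M * (2 * ‖z‖ / (R - ‖z‖)) := by ring
  have hlim : (f z).re - (f 0).re ≤ (f 0).re * (2 * ‖z‖ / (R - ‖z‖)) := by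
    refine ge_of_tendsto (x := 𝓝[>] (f 0).re)
      ((continuous_id.mul continuous_const).tendsto _ |>.mono_left nhdsWithin_le_nhds) ?_
    filter_upwards [self_mem_nhdsWithin] with M hM using key M hM
  have : (f 0).re * ((R + ‖z‖) / (R - ‖z‖)) =
      (f 0).re + (f 0).re * (2 * ‖z‖ / (R - ‖z‖)) := by
    field_simp
    ring
  linarith

end ComplexAnalysis

/-! ### Norms of positive operators -/

section Positive

variable {L : Type*} [NormedAddCommGroup L] [InnerProductSpace ℂ L] [CompleteSpace L]

/-- The form bound says `0 ≤ T ≤ c • 1`, and the norm is monotone on positive elements of a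
C⋆-algebra. -/
theorem norm_le_of_isPositive {T : L →L[ℂ] L} (hT : T.IsPositive) {c : ℝ} (hc : 0 ≤ c)
    (h : ∀ x, (inner ℂ (T x) x).re ≤ c * ‖x‖ ^ 2) : ‖T‖ ≤ c := by
  have hle : T ≤ (c : ℂ) • (1 : L →L[ℂ] L) := by
    rw [ContinuousLinearMap.le_def, ContinuousLinearMap.isPositive_def']
    refine ⟨?_, fun x => ?_⟩
    · refine IsSelfAdjoint.sub ?_ hT.isSelfAdjoint
      simp [isSelfAdjoint_iff, star_smul]
    · have : (inner ℂ x x).re = ‖x‖ ^ 2 := by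
        rw [inner_self_eq_norm_sq_to_K]; norm_cast
      have h2 := h x
      simp only [ContinuousLinearMap.reApplyInnerSelf_apply, sub_apply,
        smul_apply, one_apply_eq_self, inner_sub_left,
        inner_smul_left, map_sub, Complex.conj_ofReal, RCLike.re_to_complex, Complex.re_ofReal_mul,
        this]
      linarith
  refine (CStarAlgebra.norm_le_norm_of_nonneg_of_le
    ((ContinuousLinearMap.nonneg_iff_isPositive T).2 hT) hle).trans ?_
  rw [norm_smul, Complex.norm_real, Real.norm_of_nonneg hc]
  exact mul_le_of_le_one_right hc ContinuousLinearMap.norm_id_le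

end Positive

/-! ### Separable subspaces and change of universe -/

section Separable

variable {H : Type v} [NormedAddCommGroup H] [InnerProductSpace ℂ H]

/-- Distinct orthonormal vectors are at distance `√2`, so the balls of radius `1 / 2` around them
are disjoint. -/
theorem countable_of_orthonormal {ι : Type*} [TopologicalSpace.SeparableSpace H] {b : ι → H}
    (hb : Orthonormal ℂ b) : Countable ι := by
  refine Pairwise.countable_of_isOpen_disjoint (s := fun i => Metric.ball (b i) (1 / 2)) ?_
    (fun _ => Metric.isOpen_ball) (fun i => ⟨b i, by simp⟩)
  intro i j hij
  refine Metric.ball_disjoint_ball ?_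
  have h := norm_sub_sq (𝕜 := ℂ) (b i) (b j)
  rw [hb.1, hb.1, hb.2 hij] at h
  rw [dist_eq_norm]
  norm_num at h ⊢
  nlinarith [norm_nonneg (b i - b j)]

/-- A complete separable subspace is the range of an isometry defined on a Hilbert space in any
prescribed universe. -/
theorem exists_linearIsometry_range_eq (M : Submodule ℂ H) [CompleteSpace M] [TopologicalSpace.SeparableSpace M] :
    ∃ (ι : Type w) (V : lp (fun _ : ι => ℂ) 2 →ₗᵢ[ℂ] H), Set.range V = M := by
  obtain ⟨s, b, -⟩ := exists_hilbertBasis ℂ M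
  have : Countable s := countable_of_orthonormal b.orthonormal
  -- A countable index set can be replaced by a subset of `ℕ`, which lifts to any universe.
  obtain ⟨g, hg⟩ := exists_injective_nat s
  let e : ULift.{w} (Set.range g) ≃ s := Equiv.ulift.trans (Equiv.ofInjective g hg).symm
  let b' : HilbertBasis (ULift.{w} (Set.range g)) ℂ M :=
    HilbertBasis.mk (v := b ∘ e) (b.orthonormal.comp e e.injective) (by
      rw [e.surjective.range_comp, b.dense_span])
  refine ⟨_, M.subtypeₗᵢ.comp b'.repr.symm.toLinearIsometry, ?_⟩
  ext x
  constructor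
  · rintro ⟨y, rfl⟩
    exact (b'.repr.symm y).2
  · intro hx
    exact ⟨b'.repr ⟨x, hx⟩, by simp⟩

end Separable

/-! ### Ampliations, intertwining and the row norm -/

section Ampliation

variable {n : ℕ} {E : Type u} {H : Type v} {K : Type w}
  [NormedAddCommGroup E] [InnerProductSpace ℂ E]
  [NormedAddCommGroup H] [InnerProductSpace ℂ H]
  [NormedAddCommGroup K] [InnerProductSpace ℂ K]

variable (E) in
/-- The operator `I ⊗ T : E ⊗ K → E ⊗ H`. -/
def ampliation (T : K →L[ℂ] H) : HilbertTensor E K →L[ℂ] HilbertTensor E H :=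
  (TensorProduct.mapL (.id ℂ E) T).completion

@[simp]
theorem ampliation_coe (T : K →L[ℂ] H) (t : E ⊗[ℂ] K) :
    ampliation E T (t : HilbertTensor E K) = (TensorProduct.mapL (.id ℂ E) T t : E ⊗[ℂ] H) :=
  ContinuousLinearMap.completion_apply_coe _ _

theorem ext_coe {L : Type*} [NormedAddCommGroup L] [NormedSpace ℂ L]
    {S T : HilbertTensor E K →L[ℂ] L}
    (h : ∀ t : E ⊗[ℂ] K, S (t : HilbertTensor E K) = T (t : HilbertTensor E K)) : S = T := by
  ext x
  induction x using UniformSpace.Completion.induction_on with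
  | hp => exact isClosed_eq S.continuous T.continuous
  | ih t => exact h t

theorem ampliation_id : ampliation E (.id ℂ K) = .id ℂ (HilbertTensor E K) :=
  ext_coe fun t => by simp

theorem ampliation_comp_ampliation {L : Type*} [NormedAddCommGroup L] [InnerProductSpace ℂ L]
    (S : H →L[ℂ] L) (T : K →L[ℂ] H) :
    ampliation E S ∘L ampliation E T = ampliation E (S ∘L T) :=
  ext_coe fun t => by
    rw [ContinuousLinearMap.comp_apply, ampliation_coe, ampliation_coe, ampliation_coe,
      ← ContinuousLinearMap.comp_apply, ← TensorProduct.mapL_comp]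
    rfl

theorem opTensor_comp_ampliation (A : E →L[ℂ] E) {X : H →L[ℂ] H} {Y : K →L[ℂ] K}
    {V : K →L[ℂ] H} (h : X ∘L V = V ∘L Y) :
    opTensor A X ∘L ampliation E V = ampliation E V ∘L opTensor A Y :=
  ext_coe fun t => by
    simp only [opTensor, ContinuousLinearMap.comp_apply, ampliation_coe,
      ContinuousLinearMap.completion_apply_coe]
    rw [← ContinuousLinearMap.comp_apply, ← ContinuousLinearMap.comp_apply,
      ← TensorProduct.mapL_comp, ← TensorProduct.mapL_comp, h]
    rfl

theorem opTensor_smul (A : E →L[ℂ] E) (z : ℂ) (X : K →L[ℂ] K) :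
    opTensor A (z • X) = z • opTensor A X :=
  ext_coe fun t => by
    simp only [opTensor, ContinuousLinearMap.completion_apply_coe, smul_apply,
      TensorProduct.mapL_smul_right, UniformSpace.Completion.coe_smul]

theorem lift_comp_of_intertwining {X : Fin n → H →L[ℂ] H} {Y : Fin n → K →L[ℂ] K}
    {V : K →L[ℂ] H} (h : ∀ i, X i ∘L V = V ∘L Y i) (α : FreeMonoid (Fin n)) :
    FreeMonoid.lift X α ∘L V = V ∘L FreeMonoid.lift Y α := by
  induction α using FreeMonoid.inductionOn' with
  | one => simp only [map_one]; rfl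
  | of_mul i α ih =>
    simp only [map_mul, FreeMonoid.lift_eval_of, ContinuousLinearMap.mul_def]
    rw [ContinuousLinearMap.comp_assoc, ih, ← ContinuousLinearMap.comp_assoc, h,
      ContinuousLinearMap.comp_assoc]

theorem homPart_comp_ampliation (A : Coeff n E) {X : Fin n → H →L[ℂ] H} {Y : Fin n → K →L[ℂ] K}
    {V : K →L[ℂ] H} (h : ∀ i, X i ∘L V = V ∘L Y i) (k : ℕ) :
    homPart A X k ∘L ampliation E V = ampliation E V ∘L homPart A Y k := by
  simp only [homPart, ContinuousLinearMap.finsetSum_comp, ContinuousLinearMap.comp_finsetSum,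
    opTensor_comp_ampliation _ (lift_comp_of_intertwining h _)]

theorem lift_smul (z : ℂ) (X : Fin n → K →L[ℂ] K) (α : FreeMonoid (Fin n)) :
    FreeMonoid.lift (z • X) α = z ^ α.length • FreeMonoid.lift X α := by
  induction α using FreeMonoid.inductionOn' with
  | one => simp
  | of_mul i α ih =>
    simp only [map_mul, FreeMonoid.lift_eval_of, ih, Pi.smul_apply, FreeMonoid.length_mul,
      FreeMonoid.length_of, smul_mul_smul_comm, pow_add, pow_one]

/-- This homogeneity makes `z ↦ F(zX)` a power series in `z`. -/
theorem homPart_smul (A : Coeff n E) (z : ℂ) (X : Fin n → K →L[ℂ] K) (k : ℕ) :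
    homPart A (z • X) k = z ^ k • homPart A X k := by
  have (i : Fin k → Fin n) : (word i).length = k := by
    simp [word, FreeMonoid.length]
  simp only [homPart, lift_smul, this, opTensor_smul, Finset.smul_sum]

section Complete

variable [CompleteSpace H] [CompleteSpace K]

theorem adjoint_ampliation (T : K →L[ℂ] H) :
    (ampliation E T).adjoint = ampliation E T.adjoint := by
  refine (ContinuousLinearMap.eq_adjoint_iff _ _).2 (fun x y => ?_) |>.symm
  induction x, y using UniformSpace.Completion.induction_on₂ with
  | hp => exact isClosed_eq (by fun_prop) (by fun_prop)
  | ih x y =>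
    simp only [ampliation_coe, UniformSpace.Completion.inner_coe]
    induction x with
    | zero => simp
    | add x₁ x₂ h₁ h₂ => simp only [map_add, inner_add_left, h₁, h₂]
    | tmul e f =>
      induction y with
      | zero => simp
      | add y₁ y₂ h₁ h₂ => simp only [map_add, inner_add_right, h₁, h₂]
      | tmul e' f' => simp [ContinuousLinearMap.adjoint_inner_left]

theorem adjoint_ampliation_comp_ampliation (V : K →ₗᵢ[ℂ] H) :
    (ampliation E V.toContinuousLinearMap).adjoint ∘L ampliation E V.toContinuousLinearMap =
      .id ℂ _ := by
  rw [adjoint_ampliation, ampliation_comp_ampliation, ← ampliation_id]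
  congr 1
  exact (ContinuousLinearMap.norm_map_iff_adjoint_comp_self _).1 V.norm_map

/-- Compressing the partial sums of a series at `X` along an isometry onto an invariant subspace
gives the partial sums at the restriction of `X`. -/
theorem tendsto_sum_homPart_of_intertwining (A : Coeff n E) {X : Fin n → H →L[ℂ] H}
    {Y : Fin n → K →L[ℂ] K} (V : K →ₗᵢ[ℂ] H)
    (h : ∀ i, X i ∘L V.toContinuousLinearMap = V.toContinuousLinearMap ∘L Y i)
    {T : HilbertTensor E H →L[ℂ] HilbertTensor E H}
    (hT : Tendsto (fun N : ℕ => ∑ k ∈ Finset.range N, homPart A X k) atTop (𝓝 T)) :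
    Tendsto (fun N : ℕ => ∑ k ∈ Finset.range N, homPart A Y k) atTop
      (𝓝 ((ampliation E V.toContinuousLinearMap).adjoint ∘L T ∘L
        ampliation E V.toContinuousLinearMap)) := by
  set W := ampliation E V.toContinuousLinearMap with hW
  have hc : Continuous fun S : HilbertTensor E H →L[ℂ] HilbertTensor E H =>
      W.adjoint ∘L S ∘L W := by fun_prop
  refine (hc.tendsto T |>.comp hT).congr fun N => ?_
  simp only [Function.comp_apply, ContinuousLinearMap.finsetSum_comp,
    ContinuousLinearMap.comp_finsetSum]
  refine Finset.sum_congr rfl fun k _ => ?_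
  rw [hW, homPart_comp_ampliation A h, ← ContinuousLinearMap.comp_assoc,
    adjoint_ampliation_comp_ampliation, ContinuousLinearMap.id_comp]

theorem isPositive_sum_mul_star (X : Fin n → H →L[ℂ] H) :
    (∑ i, X i * star (X i)).IsPositive := by
  rw [← ContinuousLinearMap.nonneg_iff_isPositive]
  exact Finset.sum_nonneg fun i _ => mul_star_self_nonneg _

theorem inner_sum_mul_star (X : Fin n → H →L[ℂ] H) (x : H) :
    (inner ℂ ((∑ i, X i * star (X i)) x) x).re = ∑ i, ‖star (X i) x‖ ^ 2 := by
  rw [sum_apply, sum_inner, Complex.re_sum]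
  refine Finset.sum_congr rfl fun i _ => ?_
  rw [mul_apply_eq_comp, ← ContinuousLinearMap.adjoint_inner_right,
    ← ContinuousLinearMap.star_eq_adjoint, inner_self_eq_norm_sq_to_K]
  norm_cast

/-- The norm of the positive operator `∑ Yᵢ Yᵢ*` is governed by its form `∑ ‖Yᵢ* x‖²`, so a
pointwise comparison of adjoints along a contraction is enough. -/
theorem rowNorm_le_rowNorm {X : Fin n → H →L[ℂ] H} {Y : Fin n → K →L[ℂ] K}
    {V : K →L[ℂ] H} (hV : ‖V‖ ≤ 1) (h : ∀ i x, ‖star (Y i) x‖ ≤ ‖star (X i) (V x)‖) :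
    rowNorm Y ≤ rowNorm X := by
  refine Real.sqrt_le_sqrt (norm_le_of_isPositive (isPositive_sum_mul_star Y) (norm_nonneg _)
    fun x => ?_)
  have hx : ‖V x‖ ≤ ‖x‖ := by simpa using V.le_of_opNorm_le hV x
  calc _ = ∑ i, ‖star (Y i) x‖ ^ 2 := inner_sum_mul_star Y x
    _ ≤ ∑ i, ‖star (X i) (V x)‖ ^ 2 :=
      Finset.sum_le_sum fun i _ => pow_le_pow_left₀ (norm_nonneg _) (h i x) 2
    _ = (inner ℂ ((∑ i, X i * star (X i)) (V x)) (V x)).re := (inner_sum_mul_star X _).symm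
    _ ≤ ‖(∑ i, X i * star (X i)) (V x)‖ * ‖V x‖ := re_inner_le_norm (𝕜 := ℂ) _ _
    _ ≤ ‖∑ i, X i * star (X i)‖ * ‖V x‖ * ‖V x‖ := by
      gcongr
      exact ContinuousLinearMap.le_opNorm _ _
    _ = ‖∑ i, X i * star (X i)‖ * ‖V x‖ ^ 2 := by ring
    _ ≤ _ := by gcongr

theorem rowNorm_smul (z : ℂ) (X : Fin n → H →L[ℂ] H) : rowNorm (z • X) = ‖z‖ * rowNorm X := by
  have : ∑ i, (z • X) i * star ((z • X) i) = (z * star z) • ∑ i, X i * star (X i) := by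
    simp only [Pi.smul_apply, star_smul, smul_mul_smul_comm, Finset.smul_sum]
  rw [rowNorm, this, norm_smul, norm_mul, norm_star, Real.sqrt_mul (by positivity),
    Real.sqrt_mul_self (norm_nonneg z), rowNorm]

end Complete

end Ampliation

/-! ### Compression to invariant subspaces -/

section Compression

variable {n : ℕ} {E : Type u} {H : Type v} {K : Type w}
  [NormedAddCommGroup E] [InnerProductSpace ℂ E]
  [NormedAddCommGroup H] [InnerProductSpace ℂ H]
  [NormedAddCommGroup K] [InnerProductSpace ℂ K]

/-- The compression `(I ⊗ V)* T (I ⊗ V)`. -/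
def compress (V : K →ₗᵢ[ℂ] H) (T : HilbertTensor E H →L[ℂ] HilbertTensor E H) :
    HilbertTensor E K →L[ℂ] HilbertTensor E K :=
  (ampliation E V.toContinuousLinearMap).adjoint ∘L T ∘L ampliation E V.toContinuousLinearMap

theorem compress_rePart_add (V : K →ₗᵢ[ℂ] H)
    (S T : HilbertTensor E H →L[ℂ] HilbertTensor E H) :
    compress V (rePart S + Complex.I • rePart T) =
      rePart (compress V S) + Complex.I • rePart (compress V T) := by
  simp only [compress, rePart, ContinuousLinearMap.star_eq_adjoint,
    ContinuousLinearMap.adjoint_comp, ContinuousLinearMap.adjoint_adjoint,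
    ContinuousLinearMap.add_comp, ContinuousLinearMap.comp_add, ContinuousLinearMap.smul_comp,
    ContinuousLinearMap.comp_smul, ContinuousLinearMap.comp_assoc]

variable [CompleteSpace E] [CompleteSpace H] [CompleteSpace K] {γ : ℝ} {A B : Coeff n E}
  {F u : (Fin n → H →L[ℂ] H) → HilbertTensor E H →L[ℂ] HilbertTensor E H}

/-- The tuple `V Yᵢ V*`, which extends `Y` by zero off the range of the isometry `V`. -/
def extendByZero (V : K →ₗᵢ[ℂ] H) (Y : Fin n → K →L[ℂ] K) : Fin n → H →L[ℂ] H :=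
  fun i => V.toContinuousLinearMap ∘L Y i ∘L V.toContinuousLinearMap.adjoint

theorem adjoint_comp_self (V : K →ₗᵢ[ℂ] H) :
    V.toContinuousLinearMap.adjoint ∘L V.toContinuousLinearMap = .id ℂ K :=
  (ContinuousLinearMap.norm_map_iff_adjoint_comp_self _).1 V.norm_map

theorem norm_adjoint_le_one (V : K →ₗᵢ[ℂ] H) : ‖V.toContinuousLinearMap.adjoint‖ ≤ 1 :=
  (ContinuousLinearMap.adjoint.norm_map _).trans_le V.norm_toContinuousLinearMap_le

theorem extendByZero_comp (V : K →ₗᵢ[ℂ] H) (Y : Fin n → K →L[ℂ] K) (i : Fin n) :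
    extendByZero V Y i ∘L V.toContinuousLinearMap = V.toContinuousLinearMap ∘L Y i := by
  rw [extendByZero, ContinuousLinearMap.comp_assoc, ContinuousLinearMap.comp_assoc,
    adjoint_comp_self, ContinuousLinearMap.comp_id]

theorem extendByZero_mem_openBall (V : K →ₗᵢ[ℂ] H) {Y : Fin n → K →L[ℂ] K}
    (hY : Y ∈ openBall n K γ) : extendByZero V Y ∈ openBall n H γ := by
  refine (rowNorm_le_rowNorm (norm_adjoint_le_one V) fun i x => ?_).trans_lt hY
  rw [extendByZero, ContinuousLinearMap.star_eq_adjoint, ContinuousLinearMap.adjoint_comp,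
    ContinuousLinearMap.adjoint_comp, ContinuousLinearMap.adjoint_adjoint]
  exact (V.norm_map _).le

theorem IsFreeHolomorphicWith.compress_extendByZero (hF : IsFreeHolomorphicWith γ A F)
    (V : K →ₗᵢ[ℂ] H) :
    IsFreeHolomorphicWith γ A fun Y => compress V (F (extendByZero V Y)) :=
  ⟨hF.1, fun Y hY => tendsto_sum_homPart_of_intertwining A V (extendByZero_comp V Y)
    (hF.2 _ (extendByZero_mem_openBall V hY))⟩

/-- Supplies a representation on `K` with the same coefficients, to which a positivity hypothesis on
`K` can be applied. -/
theorem IsRepresentation.compress_extendByZero (hu : IsRepresentation γ A B u)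
    (V : K →ₗᵢ[ℂ] H) :
    IsRepresentation γ A B fun Y => compress V (u (extendByZero V Y)) := by
  obtain ⟨F, G, hF, hG, h⟩ := hu
  refine ⟨_, _, hF.compress_extendByZero V, hG.compress_extendByZero V, fun Y hY => ?_⟩
  simp only [h _ (extendByZero_mem_openBall V hY), compress_rePart_add]

/-- The compressed partial sums at `X` and at `X'` are both the partial sums at the common
restriction `Y`. The adjoint parts follow because compression commutes with taking adjoints, so the
range of `V` need not be reducing. -/
theorem IsRepresentation.compress_congr (hu : IsRepresentation γ A B u)
    {V : K →ₗᵢ[ℂ] H} {Y : Fin n → K →L[ℂ] K} {X X' : Fin n → H →L[ℂ] H}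
    (hX : X ∈ openBall n H γ) (hX' : X' ∈ openBall n H γ)
    (h : ∀ i, X i ∘L V.toContinuousLinearMap = V.toContinuousLinearMap ∘L Y i)
    (h' : ∀ i, X' i ∘L V.toContinuousLinearMap = V.toContinuousLinearMap ∘L Y i) :
    compress V (u X) = compress V (u X') := by
  obtain ⟨F, G, hF, hG, hu⟩ := hu
  have hFX : compress V (F X) = compress V (F X') :=
    tendsto_nhds_unique (tendsto_sum_homPart_of_intertwining A V h (hF.2 X hX))
      (tendsto_sum_homPart_of_intertwining A V h' (hF.2 X' hX'))
  have hGX : compress V (G X) = compress V (G X') :=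
    tendsto_nhds_unique (tendsto_sum_homPart_of_intertwining B V h (hG.2 X hX))
      (tendsto_sum_homPart_of_intertwining B V h' (hG.2 X' hX'))
  rw [hu X hX, hu X' hX', compress_rePart_add, compress_rePart_add, hFX, hGX]

/-- If every representation on `K` with the coefficients of `u` is positive, then so is the
compression of `u X` to a copy of `K` that is invariant under `X`. -/
theorem IsRepresentation.isPositive_compress (hu : IsRepresentation γ A B u)
    (hpos : ∀ U : (Fin n → K →L[ℂ] K) → HilbertTensor E K →L[ℂ] HilbertTensor E K,
      IsRepresentation γ A B U → ∀ Y ∈ openBall n K γ, (U Y).IsPositive)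
    {X : Fin n → H →L[ℂ] H} (hX : X ∈ openBall n H γ) {V : K →ₗᵢ[ℂ] H}
    (hV : ∀ i x, X i (V x) ∈ Set.range V) : (compress V (u X)).IsPositive := by
  set Y : Fin n → K →L[ℂ] K := fun i =>
    V.toContinuousLinearMap.adjoint ∘L X i ∘L V.toContinuousLinearMap with hYdef
  have hint (i : Fin n) : X i ∘L V.toContinuousLinearMap = V.toContinuousLinearMap ∘L Y i := by
    ext x
    obtain ⟨y, hy⟩ := hV i x
    have h1 : V.toContinuousLinearMap.adjoint (V y) = y :=
      DFunLike.congr_fun (adjoint_comp_self V) y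
    change X i (V x) = V (V.toContinuousLinearMap.adjoint (X i (V x)))
    rw [← hy, h1]
  have hY : Y ∈ openBall n K γ := by
    refine (rowNorm_le_rowNorm V.norm_toContinuousLinearMap_le fun i x => ?_).trans_lt hX
    simp only [hYdef, ContinuousLinearMap.star_eq_adjoint, ContinuousLinearMap.adjoint_comp,
      ContinuousLinearMap.adjoint_adjoint]
    exact (ContinuousLinearMap.le_of_opNorm_le _ (norm_adjoint_le_one V) _).trans_eq (one_mul _)
  -- `X` and the extension of `Y` by zero have the same restriction to the range of `V`, so one may
  -- replace the other.
  rw [hu.compress_congr hX (extendByZero_mem_openBall V hY) hint (extendByZero_comp V Y)]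
  exact hpos _ (hu.compress_extendByZero V) Y hY

end Compression

/-! ### Transfer of positivity between universes -/

section Universes

variable {n : ℕ} {E : Type u} {H : Type v} [NormedAddCommGroup E] [InnerProductSpace ℂ E]
  [NormedAddCommGroup H] [InnerProductSpace ℂ H]

theorem exists_finset_forall_mem_range_mapL (t : E ⊗[ℂ] H) :
    ∃ s : Finset H, ∀ {K : Type w} [NormedAddCommGroup K] [InnerProductSpace ℂ K]
      (V : K →L[ℂ] H), (s : Set H) ⊆ Set.range V →
        t ∈ Set.range (TensorProduct.mapL (.id ℂ E) V) := by
  classical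
  induction t with
  | zero => exact ⟨∅, fun V _ => ⟨0, map_zero _⟩⟩
  | tmul e x =>
    refine ⟨{x}, fun V hV => ?_⟩
    obtain ⟨y, rfl⟩ := hV (by simp : x ∈ _)
    exact ⟨e ⊗ₜ y, rfl⟩
  | add t₁ t₂ h₁ h₂ =>
    obtain ⟨s₁, h₁⟩ := h₁
    obtain ⟨s₂, h₂⟩ := h₂
    refine ⟨s₁ ∪ s₂, fun V hV => ?_⟩
    rw [Finset.coe_union, Set.union_subset_iff] at hV
    obtain ⟨a, rfl⟩ := h₁ V hV.1
    obtain ⟨b, rfl⟩ := h₂ V hV.2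
    exact ⟨a + b, map_add _ _ _⟩

/-- A finite set of vectors lies in a separable closed subspace that is invariant under finitely
many given operators; such a subspace is isometric to a Hilbert space in any universe. -/
theorem exists_linearIsometry_invariant [CompleteSpace H] (X : Fin n → H →L[ℂ] H)
    (s : Finset H) :
    ∃ (ι : Type w) (V : lp (fun _ : ι => ℂ) 2 →ₗᵢ[ℂ] H), (s : Set H) ⊆ Set.range V ∧
      ∀ i x, X i (V x) ∈ Set.range V := by
  -- The orbit of `s` under all words in `X` is countable, and its closed span is separable and
  -- invariant.
  set S : Set H := Set.range fun p : FreeMonoid (Fin n) × s => FreeMonoid.lift X p.1 (p.2 : H)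
    with hS
  set M : Submodule ℂ H := (Submodule.span ℂ S).topologicalClosure with hM
  have hSM : S ⊆ M := Submodule.subset_span.trans (Submodule.le_topologicalClosure _)
  have hcount : Countable (FreeMonoid (Fin n)) := inferInstanceAs (Countable (List (Fin n)))
  have hsep : TopologicalSpace.SeparableSpace M := by
    refine TopologicalSpace.IsSeparable.separableSpace (s := (M : Set H)) ?_
    rw [hM, Submodule.topologicalClosure_coe]
    exact ((Set.countable_range _).isSeparable.span).closure
  have hcomp : CompleteSpace M :=
    (Submodule.isClosed_topologicalClosure _).completeSpace_coe
  obtain ⟨ι, V, hV⟩ := exists_linearIsometry_range_eq.{v, w} M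
  refine ⟨ι, V, ?_, fun i x => ?_⟩
  · rw [hV]
    intro x hx
    exact hSM ⟨(1, ⟨x, hx⟩), by simp⟩
  · have hx : V x ∈ M := by
      rw [← SetLike.mem_coe, ← hV]
      exact ⟨x, rfl⟩
    rw [hV]
    refine (show M ≤ M.comap (X i : H →ₗ[ℂ] H) from ?_) hx
    refine Submodule.topologicalClosure_minimal _ (Submodule.span_le.2 ?_)
      ((Submodule.isClosed_topologicalClosure _).preimage (X i).continuous)
    rintro _ ⟨⟨α, y⟩, rfl⟩
    exact hSM ⟨(FreeMonoid.of i * α, y), by simp⟩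

variable [CompleteSpace E] [CompleteSpace H] {γ : ℝ} {A B : Coeff n E}
  {u : (Fin n → H →L[ℂ] H) → HilbertTensor E H →L[ℂ] HilbertTensor E H}

/-- Positivity of the representations on the Hilbert spaces of one universe implies positivity of
the representations on the Hilbert spaces of any other. -/
theorem IsRepresentation.isPositive (hu : IsRepresentation γ A B u)
    (hpos : ∀ (K : Type w) [NormedAddCommGroup K] [InnerProductSpace ℂ K] [CompleteSpace K]
      (U : (Fin n → K →L[ℂ] K) → HilbertTensor E K →L[ℂ] HilbertTensor E K),
      IsRepresentation γ A B U → ∀ Y ∈ openBall n K γ, (U Y).IsPositive)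
    {X : Fin n → H →L[ℂ] H} (hX : X ∈ openBall n H γ) : (u X).IsPositive := by
  rw [ContinuousLinearMap.isPositive_iff_complex]
  intro x
  -- The condition on the form is closed in `x`, so it suffices to test the dense algebraic tensors.
  induction x using UniformSpace.Completion.induction_on with
  | hp =>
    exact (isClosed_eq (by fun_prop) (by fun_prop)).inter (isClosed_Ici.preimage
      (f := fun a => RCLike.re (inner ℂ (u X a) a)) (by fun_prop))
  | ih t =>
    obtain ⟨s, hs⟩ := exists_finset_forall_mem_range_mapL.{u, v, w} t
    obtain ⟨ι, V, hsV, hV⟩ := exists_linearIsometry_invariant.{v, w} X s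
    obtain ⟨a, rfl⟩ := hs V.toContinuousLinearMap hsV
    have h := (ContinuousLinearMap.isPositive_iff_complex _).1
      (hu.isPositive_compress (hpos _) hX hV) (a : HilbertTensor E _)
    simpa only [compress, ContinuousLinearMap.comp_apply, ContinuousLinearMap.adjoint_inner_left,
      ampliation_coe] using h

end Universes

/-! ### The Harnack inequality for forms -/

section Harnack

variable {n : ℕ} {E : Type u} {H : Type v}
  [NormedAddCommGroup E] [InnerProductSpace ℂ E] [CompleteSpace E]
  [NormedAddCommGroup H] [InnerProductSpace ℂ H] [CompleteSpace H]

theorem rePart_isSelfAdjoint {L : Type*} [NormedAddCommGroup L] [InnerProductSpace ℂ L]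
    [CompleteSpace L] (T : L →L[ℂ] L) : IsSelfAdjoint (rePart T) := by
  rw [isSelfAdjoint_iff, rePart, star_smul, star_add, star_star, add_comm]
  simp

/-- `rePart T` is self-adjoint, so its form is real and the factor `I` makes it purely imaginary. -/
theorem re_inner_rePart_add {L : Type*} [NormedAddCommGroup L] [InnerProductSpace ℂ L]
    [CompleteSpace L] (S T : L →L[ℂ] L) (x : L) :
    (inner ℂ x ((rePart S + Complex.I • rePart T) x)).re = (inner ℂ x (S x)).re := by
  have h1 : (inner ℂ x (rePart T x)).im = 0 := by
    rw [← Complex.conj_eq_iff_im, inner_conj_symm]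
    exact (rePart_isSelfAdjoint T).isSymmetric x x
  have h2 : (inner ℂ x (star S x)).re = (inner ℂ x (S x)).re := by
    rw [ContinuousLinearMap.star_eq_adjoint, ContinuousLinearMap.adjoint_inner_right,
      ← inner_conj_symm, Complex.conj_re]
  have h3 : (inner ℂ x (rePart S x)).re = (inner ℂ x (S x)).re := by
    simp only [rePart, smul_apply, add_apply, inner_smul_right, inner_add_right]
    rw [show (2⁻¹ : ℂ) = ((2⁻¹ : ℝ) : ℂ) by norm_num, Complex.re_ofReal_mul, Complex.add_re, h2]
    ring
  rw [add_apply, smul_apply, inner_add_right, inner_smul_right, Complex.add_re, h3, Complex.mul_re,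
    h1]
  simp

/-- The Harnack inequality for a free pluriharmonic function that is positive on one Hilbert
space, tested against a vector. -/
theorem IsRepresentation.re_inner_le {γ r : ℝ} (hr : 0 < r) (hrγ : r < γ) {A B : Coeff n E}
    {u : (Fin n → H →L[ℂ] H) → HilbertTensor E H →L[ℂ] HilbertTensor E H}
    (hu : IsRepresentation γ A B u) (hpos : ∀ X ∈ openBall n H γ, (u X).IsPositive)
    {X : Fin n → H →L[ℂ] H} (hX : X ∈ closedBall n H r) (x : HilbertTensor E H) :
    (inner ℂ x (u X x)).re ≤ (inner ℂ x (u 0 x)).re * ((γ + r) / (γ - r)) := by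
  obtain ⟨F, G, hF, hG, h⟩ := hu
  -- The radius `γ / r` comes from `rowNorm (z • X) ≤ ‖z‖ * r < γ`; it exceeds `1`, so `z = 1` is an
  -- interior point.
  have hmem : ∀ z ∈ Metric.ball (0 : ℂ) (γ / r), z • X ∈ openBall n H γ := by
    intro z hz
    rw [mem_ball_zero_iff, lt_div_iff₀ hr] at hz
    rw [openBall, Set.mem_ofPred_eq, rowNorm_smul]
    exact (mul_le_mul_of_nonneg_left hX (norm_nonneg z)).trans_lt hz
  have hre : ∀ z ∈ Metric.ball (0 : ℂ) (γ / r),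
      (inner ℂ x (u (z • X) x)).re = (inner ℂ x (F (z • X) x)).re := fun z hz => by
    rw [h _ (hmem z hz), re_inner_rePart_add]
  have hdiff : DifferentiableOn ℂ (fun z : ℂ => inner ℂ x (F (z • X) x))
      (Metric.ball 0 (γ / r)) := by
    refine differentiableOn_of_tendsto_sum_pow (a := fun k => inner ℂ x (homPart A X k x))
      fun z hz => ?_
    have hc : Continuous fun T : HilbertTensor E H →L[ℂ] HilbertTensor E H =>
        inner ℂ x (T x) := by fun_prop
    refine ((hc.tendsto _).comp (hF.2 _ (hmem z hz))).congr fun N => ?_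
    simp only [Function.comp_apply, sum_apply, inner_sum, homPart_smul, smul_apply,
      inner_smul_right]
  have h1 : (1 : ℂ) ∈ Metric.ball (0 : ℂ) (γ / r) := by
    rw [mem_ball_zero_iff, norm_one, one_lt_div hr]
    exact hrγ
  have h0 : (0 : ℂ) ∈ Metric.ball (0 : ℂ) (γ / r) :=
    Metric.mem_ball_self (div_pos (hr.trans hrγ) hr)
  have key := re_le_of_re_nonneg hdiff
    (fun z hz => by
      rw [← hre z hz]
      exact (hpos _ (hmem z hz)).re_inner_nonneg_right x) h1
  rw [← hre 1 h1, ← hre 0 h0, one_smul, zero_smul, norm_one] at key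
  have hc : (γ / r + 1) / (γ / r - 1) = (γ + r) / (γ - r) := by
    field_simp
  rwa [hc] at key

end Harnack

end FreePluriharmonic

end

theorem theorem2p8 {n : ℕ} {E : Type u} {H : Type v}
    [NormedAddCommGroup E] [InnerProductSpace ℂ E] [CompleteSpace E]
    [NormedAddCommGroup H] [InnerProductSpace ℂ H] [CompleteSpace H]
    (γ r : ℝ) (hr : 0 < r) (hrγ : r < γ)
    (u : (Fin n → H →L[ℂ] H) →
      FreePluriharmonic.HilbertTensor E H →L[ℂ] FreePluriharmonic.HilbertTensor E H)
    (hu : FreePluriharmonic.IsPositiveFreePluriharmonicOn.{u, v, w} γ u) :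
    ∀ X ∈ FreePluriharmonic.closedBall n H r, ‖u X‖ ≤ ‖u 0‖ * ((γ + r) / (γ - r)) := by
  intro X hX
  obtain ⟨A, B, hrep, hpos⟩ := hu
  have hposH : ∀ Y ∈ FreePluriharmonic.openBall n H γ, (u Y).IsPositive :=
    fun Y hY => hrep.isPositive hpos hY
  have hc : 0 ≤ (γ + r) / (γ - r) := div_nonneg (by linarith) (by linarith)
  refine FreePluriharmonic.norm_le_of_isPositive (hposH X (lt_of_le_of_lt hX hrγ))
    (by positivity) fun x => ?_
  have h0 : (inner ℂ x (u 0 x)).re ≤ ‖u 0‖ * ‖x‖ ^ 2 :=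
    calc (inner ℂ x (u 0 x)).re ≤ ‖x‖ * ‖u 0 x‖ := re_inner_le_norm (𝕜 := ℂ) _ _
      _ ≤ ‖x‖ * (‖u 0‖ * ‖x‖) := by gcongr; exact (u 0).le_opNorm x
      _ = ‖u 0‖ * ‖x‖ ^ 2 := by ring
  calc (inner ℂ (u X x) x).re = (inner ℂ x (u X x)).re := by
        rw [← inner_conj_symm, Complex.conj_re]
    _ ≤ (inner ℂ x (u 0 x)).re * ((γ + r) / (γ - r)) :=
      hrep.re_inner_le hr hrγ hposH hX x
    _ ≤ ‖u 0‖ * ‖x‖ ^ 2 * ((γ + r) / (γ - r)) := by gcongr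
    _ = ‖u 0‖ * ((γ + r) / (γ - r)) * ‖x‖ ^ 2 := by ring
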